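/- Let $n,m,L,T,N_v$ be natural numbers. A plant is a tuple $(\{A_\ell\}_{\ell=1}^L,B)$ with $A_\ell\in\mathbb R^{n\times n}$, $B\in\mathbb R^{n\times m}$, describing $x_+=(\sum_{\ell}\theta_\ell A_\ell)x+Bu$; write $[\{A_\ell\},B]=[A_1,\dots,A_L,B]\in\mathbb R^{n\times(Ln+m)}$. The data $\mathcal D=(\mathbf X_-,\mathbf U,\mathbf\Theta,\mathbf X_+)$ are matrices in $\mathbb R^{n\times T},\mathbb R^{m\times T},\mathbb R^{L\times T},\mathbb R^{n\times T}$ whose columns are the recorded $x(t),u(t),\theta(t)$ and next states $x_+(t)$. The discrepancy $\mathbf W\in\mathbb R^{n\times T}$ of a plant has columns $x_+(t)-(\sum_\ell\theta_\ell(t)A_\ell)x(t)-Bu(t)$. For a symmetric matrix $M$ of size $n+k$ and $Z\in\mathbb R^{n\times k}$ write $Z\in\mathrm{QBP}(M)$ (resp. $Z\in\mathrm{SQBP}(M)$) if $\begin{bmatrix}I_n\\Z^T\end{bmatrix}^TM\begin{bmatrix}I_n\\Z^T\end{bmatrix}$ is positive semidefinite (resp. positive definite). Let $\Phi\in\mathbb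 S^{n+T}$ be symmetric with lower right $T\times T$ block satisfying $-\Phi_{22}\succeq0$, let $\Sigma_{\mathcal D}(\Phi)$ be the set of plants whose discrepancy is in $\mathrm{QBP}(\Phi)$, and assume that a ground-truth plant exists in $\Sigma_{\mathcal D}(\Phi)$. Put $$G=\begin{bmatrix}I_n&\mathbf X_+\\0&-\mathbf\Theta\otimes_{\mathrm{col}}\mathbf X_-\\0&-\mathbf U\end{bmatrix},\qquad \Psi=G\,\Phi\,G^T,$$ where column $t$ of $\mathbf\Theta\otimes_{\mathrm{col}}\mathbf X_-$ is $\theta(t)\otimes x(t)$. Let $\omega_1,\dots,\omega_{N_v}\in\mathbb R^L$ be the vertices of the parameter polytope. (i) Let $P\in\mathbb S^n_{++}$ and $K_1,\dots,K_{N_v}\in\mathbb R^{m\times n}$. For every $v$, the vertex quadratic matrix inequality $$[\{A_\ell\},B]\in\mathrm{SQBP}\begin{pmatrix}P&*&*\\0&-(\omega_v\omega_v^T)\otimes P&*\\0&-\omega_v^T\otimes(K_vP)&-K_vPK_v^T\end{pmatrix}$$ holds for all $(\{A_\ell\},B)\in\Sigma_{\mathcal D}(\Phi)$ if and only if there exist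 $\alpha_v\ge0$ and $\beta_v>0$ such that $$\begin{bmatrix}P-\beta_vI_n&*&*\\0&-(\omega_v\omega_v^T)\otimes P&*\\0&-\omega_v^T\otimes(K_vP)&-K_vPK_v^T\end{bmatrix}-\alpha_v\Psi\succeq0.$$ (ii) For every $P\in\mathbb S^n_{++}$, $S_v\in\mathbb R^{m\times n}$ and $\alpha_v,\beta_v\in\mathbb R$, the last inequality with $K_v=S_vP^{-1}$ is equivalent to the linear matrix inequality $$\begin{bmatrix}P-\beta_vI_n&0&0&0\\0&-(\omega_v\omega_v^T)\otimes P&-\omega_v\otimes S_v^T&0\\0&-\omega_v^T\otimes S_v&0&S_v\\0&0&S_v^T&P\end{bmatrix}-\alpha_v\begin{bmatrix}\Psi&0\\0&0_{n\times n}\end{bmatrix}\succeq0.$$ (iii) Consequently, given $P\in\mathbb R^{n\times n}$ and $S_1,\dots,S_{N_v}\in\mathbb R^{m\times n}$, there are $\alpha,\beta\in\mathbb R^{N_v}$ such that $(P,\alpha,\beta,S)$ is feasible for the discrete-time stabilization SDP (that is, $P\in\mathbb S^n_{++}$, and for all $v$: $\alpha_v\ge0$, $\beta_v>0$ and the linear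 matrix inequality in (ii) holds) if and only if $P\in\mathbb S^n_{++}$ and, with $K_v=S_vP^{-1}$, the vertex quadratic matrix inequality in (i) holds for all $v$ and all plants in $\Sigma_{\mathcal D}(\Phi)$. -/

import Mathlib

open Matrix
open scoped Kronecker

namespace LPV

/-- The data tuple `(X₋, U, Θ, X₊)`: recorded states, inputs, parameters and next states, one
column for each of the `T` recorded samples. -/
structure Data (n m L T : ℕ) where
  Xminus : Matrix (Fin n) (Fin T) ℝ
  U : Matrix (Fin m) (Fin T) ℝ
  Theta : Matrix (Fin L) (Fin T) ℝ
  Xplus : Matrix (Fin n) (Fin T) ℝ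

/-- A plant `({A_ℓ}, B)` of `x₊ = (∑ ℓ, θ_ℓ A_ℓ) x + B u`. -/
structure Plant (n m L : ℕ) where
  A : Fin L → Matrix (Fin n) (Fin n) ℝ
  B : Matrix (Fin n) (Fin m) ℝ

/-- The horizontal concatenation `[A_1, …, A_L, B]`; column `(ℓ, j)` is column `j` of `A_ℓ`. -/
def Plant.concat {n m L : ℕ} (p : Plant n m L) :
    Matrix (Fin n) ((Fin L × Fin n) ⊕ Fin m) ℝ :=
  fromCols (Matrix.of fun i lj => p.A lj.1 i lj.2) p.B

/-- The discrepancy `W` of the data under a plant; its column `t` is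
`x₊(t) - (∑ ℓ, θ_ℓ(t) A_ℓ) x(t) - B u(t)`. -/
def discrepancy {n m L T : ℕ} (D : Data n m L T) (p : Plant n m L) :
    Matrix (Fin n) (Fin T) ℝ :=
  Matrix.of fun i t =>
    D.Xplus i t - ((∑ l, D.Theta l t • p.A l) *ᵥ (fun j => D.Xminus j t)) i
      - (p.B *ᵥ (fun j => D.U j t)) i

/-- The matrix `[I; Zᵀ]ᵀ Φ [I; Zᵀ]`. -/
def quadForm {n : ℕ} {κ : Type} [Fintype κ] (Φ : Matrix (Fin n ⊕ κ) (Fin n ⊕ κ) ℝ)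
    (Z : Matrix (Fin n) κ ℝ) : Matrix (Fin n) (Fin n) ℝ :=
  (fromRows (1 : Matrix (Fin n) (Fin n) ℝ) Zᵀ)ᵀ * Φ * fromRows (1 : Matrix (Fin n) (Fin n) ℝ) Zᵀ

/-- The quadratic boundedness property: the matrices `Z` with `[I; Zᵀ]ᵀ Φ [I; Zᵀ] ⪰ 0`. -/
def QBP {n : ℕ} {κ : Type} [Fintype κ] (Φ : Matrix (Fin n ⊕ κ) (Fin n ⊕ κ) ℝ) :
    Set (Matrix (Fin n) κ ℝ) :=
  {Z | (quadForm Φ Z).PosSemidef}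

/-- The strict quadratic boundedness property: the matrices `Z` with `[I; Zᵀ]ᵀ Φ [I; Zᵀ] ≻ 0`. -/
def SQBP {n : ℕ} {κ : Type} [Fintype κ] (Φ : Matrix (Fin n ⊕ κ) (Fin n ⊕ κ) ℝ) :
    Set (Matrix (Fin n) κ ℝ) :=
  {Z | (quadForm Φ Z).PosDef}

/-- `Φ` is a symmetric matrix whose lower right block satisfies `-Φ₂₂ ⪰ 0`. -/
def IsNoiseMatrix {n T : ℕ} (Φ : Matrix (Fin n ⊕ Fin T) (Fin n ⊕ Fin T) ℝ) : Prop :=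
  Φ.IsSymm ∧ (-Φ.toBlocks₂₂).PosSemidef

/-- The set of plants that are consistent with the data, given the noise matrix `Φ`. -/
def consistencySet {n m L T : ℕ} (D : Data n m L T)
    (Φ : Matrix (Fin n ⊕ Fin T) (Fin n ⊕ Fin T) ℝ) : Set (Plant n m L) :=
  {p | discrepancy D p ∈ QBP Φ}

/-- The column-wise Khatri-Rao product: column `t` is the Kronecker product of the columns `t` of
the two factors, where the first factor gives the outer (block) index, as in `[A_1, …, A_L]`. -/
def khatriRao {a b c : Type} (X : Matrix a c ℝ) (Y : Matrix b c ℝ) : Matrix (a × b) c ℝ :=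
  Matrix.of fun i t => X i.1 t * Y i.2 t

/-- The block matrix `[I, X₊; 0, -Θ ⊗_col X₋; 0, -U]`. -/
def dataMatrix {n m L T : ℕ} (D : Data n m L T) :
    Matrix (Fin n ⊕ ((Fin L × Fin n) ⊕ Fin m)) (Fin n ⊕ Fin T) ℝ :=
  fromBlocks 1 D.Xplus 0 (fromRows (-khatriRao D.Theta D.Xminus) (-D.U))

/-- The matrix `Ψ` of the quadratic description of the consistent plants. -/
def Psi {n m L T : ℕ} (D : Data n m L T) (Φ : Matrix (Fin n ⊕ Fin T) (Fin n ⊕ Fin T) ℝ) :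
    Matrix (Fin n ⊕ ((Fin L × Fin n) ⊕ Fin m)) (Fin n ⊕ ((Fin L × Fin n) ⊕ Fin m)) ℝ :=
  dataMatrix D * Φ * (dataMatrix D)ᵀ

/-- The Kronecker product `ωᵀ ⊗ S` of a row vector and a matrix, with rows indexed by `Fin m`. -/
def rowKron {n m L : ℕ} (ω : Fin L → ℝ) (S : Matrix (Fin m) (Fin n) ℝ) :
    Matrix (Fin m) (Fin L × Fin n) ℝ :=
  (replicateRow Unit ω ⊗ₖ S).submatrix (fun i => ((), i)) id

/-- The symmetric block matrix `[Q, *, *; 0, -(ω ωᵀ) ⊗ P, *; 0, -ωᵀ ⊗ S, R]`. -/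
def vertexBlock {n m L : ℕ} (ω : Fin L → ℝ) (Q P : Matrix (Fin n) (Fin n) ℝ)
    (S : Matrix (Fin m) (Fin n) ℝ) (R : Matrix (Fin m) (Fin m) ℝ) :
    Matrix (Fin n ⊕ ((Fin L × Fin n) ⊕ Fin m)) (Fin n ⊕ ((Fin L × Fin n) ⊕ Fin m)) ℝ :=
  fromBlocks Q 0 0
    (fromBlocks (-(vecMulVec ω ω ⊗ₖ P)) (-rowKron ω S)ᵀ (-rowKron ω S) R)

/-- The matrix of the vertex stabilization QMI:
`[P, *, *; 0, -(ω ωᵀ) ⊗ P, *; 0, -ωᵀ ⊗ (K P), -K P Kᵀ]`. -/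
def stabMatrix {n m L : ℕ} (ω : Fin L → ℝ) (P : Matrix (Fin n) (Fin n) ℝ)
    (K : Matrix (Fin m) (Fin n) ℝ) :
    Matrix (Fin n ⊕ ((Fin L × Fin n) ⊕ Fin m)) (Fin n ⊕ ((Fin L × Fin n) ⊕ Fin m)) ℝ :=
  vertexBlock ω P P (K * P) (-(K * P * Kᵀ))

/-- The matrix `[P - β I, *, *; 0, -(ω ωᵀ) ⊗ P, *; 0, -ωᵀ ⊗ (K P), -K P Kᵀ] - α Ψ`. -/
def certMatrix {n m L : ℕ}
    (Ψ : Matrix (Fin n ⊕ ((Fin L × Fin n) ⊕ Fin m)) (Fin n ⊕ ((Fin L × Fin n) ⊕ Fin m)) ℝ)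
    (ω : Fin L → ℝ) (P : Matrix (Fin n) (Fin n) ℝ) (K : Matrix (Fin m) (Fin n) ℝ) (α β : ℝ) :
    Matrix (Fin n ⊕ ((Fin L × Fin n) ⊕ Fin m)) (Fin n ⊕ ((Fin L × Fin n) ⊕ Fin m)) ℝ :=
  vertexBlock ω (P - β • 1) P (K * P) (-(K * P * Kᵀ)) - α • Ψ

/-- The matrix `Γ(β) - α [Ψ, 0; 0, 0]`, where
`Γ(β) = [P - β I, 0, 0, 0; 0, -(ω ωᵀ) ⊗ P, -ω ⊗ Sᵀ, 0; 0, -ωᵀ ⊗ S, 0, S; 0, 0, Sᵀ, P]`. -/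
def sdpMatrix {n m L : ℕ}
    (Ψ : Matrix (Fin n ⊕ ((Fin L × Fin n) ⊕ Fin m)) (Fin n ⊕ ((Fin L × Fin n) ⊕ Fin m)) ℝ)
    (ω : Fin L → ℝ) (P : Matrix (Fin n) (Fin n) ℝ) (S : Matrix (Fin m) (Fin n) ℝ) (α β : ℝ) :
    Matrix ((Fin n ⊕ ((Fin L × Fin n) ⊕ Fin m)) ⊕ Fin n)
      ((Fin n ⊕ ((Fin L × Fin n) ⊕ Fin m)) ⊕ Fin n) ℝ :=
  fromBlocks (vertexBlock ω (P - β • 1) P S 0) (fromRows 0 (fromRows 0 S))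
      (fromCols 0 (fromCols 0 Sᵀ)) P
    - α • fromBlocks Ψ 0 0 0

/-- `(P, α, β, S)` is feasible for the discrete-time stabilization semidefinite program. -/
def SDPFeasible {n m L T Nv : ℕ} (D : Data n m L T)
    (Φ : Matrix (Fin n ⊕ Fin T) (Fin n ⊕ Fin T) ℝ) (ω : Fin Nv → Fin L → ℝ)
    (P : Matrix (Fin n) (Fin n) ℝ) (α β : Fin Nv → ℝ)
    (S : Fin Nv → Matrix (Fin m) (Fin n) ℝ) : Prop :=
  P.PosDef ∧ ∀ v, 0 ≤ α v ∧ 0 < β v ∧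
    (sdpMatrix (Psi D Φ) (ω v) P (S v) (α v) (β v)).PosSemidef

end LPV

/-! A plant enters the data only through `Z = [A₁, …, A_L, B]`, so consistency is the quadratic
inequality of `Psi` in `Z`. The vertex condition is also quadratic, with zero off-diagonal blocks
and lower block `-J P Jᵀ`, where `J = vertexGain ω K` stacks `ω ⊗ I` over `K`. Thus (i) is a strict
matrix S-lemma, `exists_blockForm_multiplier`; (ii) is a Schur complement with respect to `P`; (iii)
combines the two. In (i), a certificate gives the strict inequality at once, because `β > 0`.

The converse assumes neither a Slater point nor a bounded solution set. Write `N` for the data form.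
The condition bounds `Jᵀ Zᵀ x` over all solutions `Z`, so a ray of solutions cannot move the closed
loop. Hence `Jᵀ` vanishes on `ker N₂₂`, and either `Jᵀ = 0`, which is trivial, or `ker N₂₂ ≤ ker
N₁₂`. In the second case the square can be completed: `N` at `(x, Cᵀ x + d)` equals `x ⬝ᵥ S *ᵥ x -
|B d|²` with `S` positive semidefinite. Every vector pair with `x ≠ 0` and nonnegative value extends
to a matrix solution, so the matrix implication becomes one about vectors.

Since `Jᵀ` factors through `N₂₂`, only `B d` matters, and it ranges over a compact set once `x` is
normalized. Strictness therefore yields one margin `δ` that both relaxes the premise and tightens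
the conclusion. The relaxed premise has a strictly positive point, so the homogeneous S-lemma
applies and gives `α`, with `β = δ`. -/

namespace LPV

/-! ### Real quadratic forms, the S-lemma and matrix factorizations -/

section QuadraticForms

variable {ι κ ν : Type*} [Fintype ι] [Fintype κ]

theorem dotProduct_self_nonneg_real (x : ι → ℝ) : 0 ≤ x ⬝ᵥ x := by
  simpa using dotProduct_star_self_nonneg x

theorem dotProduct_mulVec_comm_of_isSymm {M : Matrix ι ι ℝ} (hM : M.IsSymm) (u v : ι → ℝ) :
    u ⬝ᵥ M *ᵥ v = v ⬝ᵥ M *ᵥ u := by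
  rw [dotProduct_mulVec, ← mulVec_transpose, hM.eq, dotProduct_comm]

theorem form_add_smul {M : Matrix ι ι ℝ} (hM : M.IsSymm) (u v : ι → ℝ) (t : ℝ) :
    (u + t • v) ⬝ᵥ M *ᵥ (u + t • v) =
      u ⬝ᵥ M *ᵥ u + 2 * t * (u ⬝ᵥ M *ᵥ v) + t ^ 2 * (v ⬝ᵥ M *ᵥ v) := by
  simp only [mulVec_add, mulVec_smul, add_dotProduct, dotProduct_add, smul_dotProduct,
    dotProduct_smul, smul_eq_mul, dotProduct_mulVec_comm_of_isSymm hM v u]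
  ring

/-- If `M` is positive definite and the form stays bounded along a ray, the direction is zero. -/
theorem eq_zero_of_form_bounded_on_ray {M : Matrix ι ι ℝ} (hM : M.PosDef) {b c : ι → ℝ} {r : ℝ}
    (h : ∀ s : ℝ, 0 ≤ s → (b + s • c) ⬝ᵥ M *ᵥ (b + s • c) ≤ r) : c = 0 := by
  by_contra hc
  have hg : 0 < c ⬝ᵥ M *ᵥ c := by simpa using hM.dotProduct_mulVec_pos hc
  have hs : M.IsSymm := by simpa using hM.isHermitian
  have hb : 0 ≤ b ⬝ᵥ M *ᵥ b := by simpa using hM.posSemidef.dotProduct_mulVec_nonneg b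
  set g := c ⬝ᵥ M *ᵥ c
  set e := b ⬝ᵥ M *ᵥ c
  -- For this `s ≥ 1` the quadratic and cross terms together are at least `s * (|r| + 1 + g)`, which
  -- exceeds `r`.
  have hs0 : 0 ≤ (2 * |e| + |r| + 1) / g + 1 := by positivity
  have := h _ hs0
  rw [form_add_smul hs] at this
  set s := (2 * |e| + |r| + 1) / g + 1 with hsdef
  have hsg : s * g = 2 * |e| + |r| + 1 + g := by
    rw [hsdef]; field_simp
  have h1 : 1 ≤ s := by
    rw [hsdef]; have : 0 ≤ (2 * |e| + |r| + 1) / g := by positivity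
    linarith
  have h2 : s ^ 2 * g = s * (2 * |e| + |r| + 1 + g) := by rw [← hsg]; ring
  have h3 : -(s * |e|) ≤ s * e := by nlinarith [neg_abs_le e]
  nlinarith [abs_nonneg r, le_abs_self r, abs_nonneg e]

/-- The homogeneous S-lemma. -/
theorem exists_multiplier_of_form_nonneg {M N : Matrix ι ι ℝ} (hM : M.IsSymm) (hN : N.IsSymm)
    (h : ∀ w : ι → ℝ, 0 ≤ w ⬝ᵥ N *ᵥ w → 0 ≤ w ⬝ᵥ M *ᵥ w)
    {w₀ : ι → ℝ} (hw₀ : 0 < w₀ ⬝ᵥ N *ᵥ w₀) :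
    ∃ α : ℝ, 0 ≤ α ∧ ∀ w : ι → ℝ, α * (w ⬝ᵥ N *ᵥ w) ≤ w ⬝ᵥ M *ᵥ w := by
  have key : ∀ u v : ι → ℝ, 0 < u ⬝ᵥ N *ᵥ u → v ⬝ᵥ N *ᵥ v < 0 →
      (v ⬝ᵥ M *ᵥ v) / (v ⬝ᵥ N *ᵥ v) ≤ (u ⬝ᵥ M *ᵥ u) / (u ⬝ᵥ N *ᵥ u) := by
    intro u v hu hv
    by_contra! hlt
    -- With `α` strictly between the ratios, the form of `M - α N` is negative at both `u` and `v`.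
    obtain ⟨α, h1, h2⟩ := exists_between hlt
    rw [div_lt_iff₀ hu] at h1
    rw [lt_div_iff_of_neg hv] at h2
    -- Replacing `v` by `-v` flips only the cross term; once it is nonpositive, `M - α N` stays
    -- negative at `u + t • v` for all `t ≥ 0`.
    wlog hb : u ⬝ᵥ M *ᵥ v - α * (u ⬝ᵥ N *ᵥ v) ≤ 0 generalizing v
    · refine this (-v) ?_ ?_ ?_ ?_ <;>
        simp only [mulVec_neg, dotProduct_neg, neg_dotProduct, neg_neg] <;> linarith
    set a := u ⬝ᵥ N *ᵥ u
    set b := u ⬝ᵥ N *ᵥ v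
    set c := v ⬝ᵥ N *ᵥ v
    set d := √(b ^ 2 - a * c) with hd
    have hac : a * c < 0 := mul_neg_of_pos_of_neg hu hv
    have hd2 : d ^ 2 = b ^ 2 - a * c := Real.sq_sqrt (by nlinarith [sq_nonneg b])
    have hdb : -b < d := by
      apply Real.lt_sqrt_of_sq_lt
      linarith [neg_sq b]
    have hdb' : b < d := Real.lt_sqrt_of_sq_lt (by linarith)
    -- The positive root of `N` along `u + t • v`: there the hypothesis forces `M ≥ 0`, a
    -- contradiction.
    set t := (b + d) / (-c) with ht
    have ht0 : 0 < t := div_pos (by linarith) (by linarith)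
    have htc : t * c = -(b + d) := by
      have := hv.ne
      rw [ht]; field_simp
    have hroot : a + 2 * t * b + t ^ 2 * c = 0 := by
      have : c * (a + 2 * t * b + t ^ 2 * c) = 0 := by
        have : c * (a + 2 * t * b + t ^ 2 * c) = a * c + 2 * (t * c) * b + (t * c) ^ 2 := by ring
        rw [this, htc]; nlinarith
      rcases mul_eq_zero.mp this with h0 | h0
      · exact absurd h0 hv.ne
      · exact h0
    have hw := h (u + t • v) (by rw [form_add_smul hN]; exact hroot.ge)
    rw [form_add_smul hM] at hw
    have e1 : 0 ≤ -(u ⬝ᵥ M *ᵥ v - α * b) * t := mul_nonneg (by linarith) ht0.le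
    have e2 : 0 < (α * c - v ⬝ᵥ M *ᵥ v) * t ^ 2 := mul_pos (by linarith) (by positivity)
    have e3 : α * (a + 2 * t * b + t ^ 2 * c) = 0 := by rw [hroot, mul_zero]
    nlinarith
  set U : Set ℝ := {r | ∃ u : ι → ℝ, 0 < u ⬝ᵥ N *ᵥ u ∧ (u ⬝ᵥ M *ᵥ u) / (u ⬝ᵥ N *ᵥ u) = r} with hU
  have hne : U.Nonempty := ⟨_, w₀, hw₀, rfl⟩
  have hlb : ∀ r ∈ U, 0 ≤ r := by
    rintro r ⟨u, hu, rfl⟩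
    exact div_nonneg (h u hu.le) hu.le
  refine ⟨sInf U, le_csInf hne hlb, fun w => ?_⟩
  rcases lt_trichotomy (w ⬝ᵥ N *ᵥ w) 0 with hw | hw | hw
  · have : (w ⬝ᵥ M *ᵥ w) / (w ⬝ᵥ N *ᵥ w) ≤ sInf U := by
      refine le_csInf hne ?_
      rintro r ⟨u, hu, rfl⟩
      exact key u w hu hw
    rwa [div_le_iff_of_neg hw] at this
  · rw [hw, mul_zero]; exact h w hw.ge
  · have : sInf U ≤ (w ⬝ᵥ M *ᵥ w) / (w ⬝ᵥ N *ᵥ w) := csInf_le ⟨0, hlb⟩ ⟨w, hw, rfl⟩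
    rwa [le_div_iff₀ hw] at this

/-- A matrix whose kernel contains the kernel of `R` factors through `R`. -/
theorem exists_mul_eq_of_ker_le {R : Matrix ι κ ℝ} {G : Matrix ν κ ℝ}
    (h : ∀ v, R *ᵥ v = 0 → G *ᵥ v = 0) : ∃ C : Matrix ν ι ℝ, C * R = G := by
  classical
  obtain ⟨s, hs⟩ := R.mulVecLin.rangeRestrict.exists_rightInverse_of_surjective
    R.mulVecLin.range_rangeRestrict
  obtain ⟨s', hs'⟩ := s.exists_extend
  refine ⟨LinearMap.toMatrix' (G.mulVecLin ∘ₗ s'), ?_⟩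
  have hG : ∀ x, LinearMap.toMatrix' (G.mulVecLin ∘ₗ s') *ᵥ (R *ᵥ x) = G *ᵥ x := by
    intro x
    rw [LinearMap.toMatrix'_mulVec, LinearMap.comp_apply, mulVecLin_apply]
    have h1 : s' (R *ᵥ x) = s (R.mulVecLin.rangeRestrict x) := by
      rw [← hs']; rfl
    have h2 : R *ᵥ s (R.mulVecLin.rangeRestrict x) = R *ᵥ x :=
      congrArg Subtype.val (LinearMap.congr_fun hs (R.mulVecLin.rangeRestrict x))
    have h3 := h (s (R.mulVecLin.rangeRestrict x) - x) (by rw [mulVec_sub, h2, sub_self])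
    rw [h1]
    rwa [mulVec_sub, sub_eq_zero] at h3
  refine ext_of_mulVec_single fun i => ?_
  rw [← mulVec_mulVec, hG]

open scoped MatrixOrder Matrix.Norms.L2Operator in
theorem exists_eq_transpose_mul_self {R : Matrix κ κ ℝ} (hR : R.PosSemidef) :
    ∃ B : Matrix κ κ ℝ, R = Bᵀ * B := by
  classical
  obtain ⟨B, hB⟩ := CStarAlgebra.nonneg_iff_eq_star_mul_self.mp hR.nonneg
  exact ⟨B, by rw [hB, star_eq_conjTranspose, conjTranspose_eq_transpose_of_trivial]⟩

theorem form_nonneg_cauchySchwarz {S : Matrix ι ι ℝ} (hS : S.PosSemidef) (u v : ι → ℝ) :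
    (u ⬝ᵥ S *ᵥ v) ^ 2 ≤ (u ⬝ᵥ S *ᵥ u) * (v ⬝ᵥ S *ᵥ v) := by
  have hs : S.IsSymm := by simpa using hS.isHermitian
  have h : ∀ t : ℝ, 0 ≤ (v ⬝ᵥ S *ᵥ v) * (t * t) + 2 * (u ⬝ᵥ S *ᵥ v) * t + u ⬝ᵥ S *ᵥ u := by
    intro t
    have := hS.dotProduct_mulVec_nonneg (u + t • v)
    rw [star_trivial, form_add_smul hs] at this
    linarith
  have := discrim_le_zero h
  rw [discrim] at this
  linarith

end QuadraticForms

/-! ### The strict matrix S-lemma without a Slater condition -/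

section BlockForm

variable {ν κ : Type*} [Fintype ν] [Fintype κ]

/-- The quadratic form of the symmetric block matrix `[N₁₁, N₁₂; N₁₂ᵀ, N₂₂]`. -/
def blockForm (N₁₁ : Matrix ν ν ℝ) (N₁₂ : Matrix ν κ ℝ) (N₂₂ : Matrix κ κ ℝ) (x : ν → ℝ)
    (z : κ → ℝ) : ℝ :=
  x ⬝ᵥ N₁₁ *ᵥ x + 2 * (x ⬝ᵥ N₁₂ *ᵥ z) + z ⬝ᵥ N₂₂ *ᵥ z

theorem form_fromBlocks (N₁₁ : Matrix ν ν ℝ) (N₁₂ : Matrix ν κ ℝ) (N₂₂ : Matrix κ κ ℝ)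
    (x : ν → ℝ) (z : κ → ℝ) :
    Sum.elim x z ⬝ᵥ fromBlocks N₁₁ N₁₂ N₁₂ᵀ N₂₂ *ᵥ Sum.elim x z = blockForm N₁₁ N₁₂ N₂₂ x z := by
  have : z ⬝ᵥ N₁₂ᵀ *ᵥ x = x ⬝ᵥ N₁₂ *ᵥ z := by
    rw [dotProduct_mulVec, vecMul_transpose, dotProduct_comm]
  simp only [fromBlocks_mulVec, sumElim_dotProduct_sumElim, dotProduct_add, blockForm,
    Sum.elim_comp_inl, Sum.elim_comp_inr, this]
  ring

theorem blockForm_add {N₁₁ : Matrix ν ν ℝ} {N₁₂ : Matrix ν κ ℝ} {N₂₂ : Matrix κ κ ℝ}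
    (h : N₂₂.IsSymm) (x : ν → ℝ) (z u : κ → ℝ) :
    blockForm N₁₁ N₁₂ N₂₂ x (z + u) = blockForm N₁₁ N₁₂ N₂₂ x z +
      2 * (x ⬝ᵥ N₁₂ *ᵥ u + z ⬝ᵥ N₂₂ *ᵥ u) + u ⬝ᵥ N₂₂ *ᵥ u := by
  simp only [blockForm, mulVec_add, add_dotProduct, dotProduct_add,
    dotProduct_mulVec_comm_of_isSymm h u z]
  ring

theorem transpose_mulVec_form (J : Matrix κ ν ℝ) (P : Matrix ν ν ℝ) (z : κ → ℝ) :
    z ⬝ᵥ (J * P * Jᵀ) *ᵥ z = (Jᵀ *ᵥ z) ⬝ᵥ P *ᵥ (Jᵀ *ᵥ z) := by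
  rw [← mulVec_mulVec, ← mulVec_mulVec, dotProduct_mulVec, ← mulVec_transpose]

variable {N₁₁ : Matrix ν ν ℝ} {N₁₂ : Matrix ν κ ℝ} {N₂₂ : Matrix κ κ ℝ} {P : Matrix ν ν ℝ}
  {J : Matrix κ ν ℝ} {Z₀ : Matrix ν κ ℝ}

/-- If a family of solutions of a QMI moves the closed loop along a ray, then the direction of the
ray is zero. -/
theorem eq_zero_of_closedLoop_ray (hP : P.PosDef)
    (h : ∀ Z : Matrix ν κ ℝ, (∀ x, 0 ≤ blockForm N₁₁ N₁₂ N₂₂ x (Zᵀ *ᵥ x)) →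
      ∀ x, x ≠ 0 → (Jᵀ *ᵥ (Zᵀ *ᵥ x)) ⬝ᵥ P *ᵥ (Jᵀ *ᵥ (Zᵀ *ᵥ x)) < x ⬝ᵥ P *ᵥ x)
    (Z : ℝ → Matrix ν κ ℝ)
    (hZ : ∀ s, 0 ≤ s → ∀ x, 0 ≤ blockForm N₁₁ N₁₂ N₂₂ x ((Z s)ᵀ *ᵥ x))
    {a : ν → ℝ} (ha : a ≠ 0) {b c : ν → ℝ}
    (hr : ∀ s, Jᵀ *ᵥ ((Z s)ᵀ *ᵥ a) = b + s • (a ⬝ᵥ a) • c) : c = 0 := by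
  have h0 : (a ⬝ᵥ a) • c = 0 := by
    refine eq_zero_of_form_bounded_on_ray hP (b := b) (r := a ⬝ᵥ P *ᵥ a) fun s hs => ?_
    rw [← hr]
    exact (h _ (hZ s hs) a ha).le
  exact (smul_eq_zero.mp h0).resolve_left (fun e => ha (dotProduct_self_eq_zero.mp e))

/-- A direction of `ker N₂₂` is not seen by the closed loop of a bounded family. -/
theorem closedLoop_eq_zero_of_mem_ker [Nonempty ν] (hN₂₂ : N₂₂.IsSymm) (hP : P.PosDef)
    (hZ₀ : ∀ x, 0 ≤ blockForm N₁₁ N₁₂ N₂₂ x (Z₀ᵀ *ᵥ x))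
    (h : ∀ Z : Matrix ν κ ℝ, (∀ x, 0 ≤ blockForm N₁₁ N₁₂ N₂₂ x (Zᵀ *ᵥ x)) →
      ∀ x, x ≠ 0 → (Jᵀ *ᵥ (Zᵀ *ᵥ x)) ⬝ᵥ P *ᵥ (Jᵀ *ᵥ (Zᵀ *ᵥ x)) < x ⬝ᵥ P *ᵥ x)
    {v : κ → ℝ} (hv : N₂₂ *ᵥ v = 0) : Jᵀ *ᵥ v = 0 := by
  classical
  -- Adding `s • vecMulVec a v` to `Z₀` changes the form by `2 s` times this product; `a = N₁₂ *ᵥ v`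
  -- makes it a square.
  obtain ⟨a, ha, hav⟩ : ∃ a : ν → ℝ, a ≠ 0 ∧ ∀ x, 0 ≤ (x ⬝ᵥ a) * (x ⬝ᵥ N₁₂ *ᵥ v) := by
    by_cases hw : N₁₂ *ᵥ v = 0
    · exact ⟨1, one_ne_zero, fun x => by simp [hw]⟩
    · exact ⟨_, hw, fun x => mul_self_nonneg _⟩
  have hmul : ∀ (s : ℝ) (x : ν → ℝ),
      (Z₀ + s • vecMulVec a v)ᵀ *ᵥ x = Z₀ᵀ *ᵥ x + (s * (x ⬝ᵥ a)) • v := by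
    intro s x
    rw [transpose_add, transpose_smul, transpose_vecMulVec, add_mulVec, smul_mulVec,
      vecMulVec_mulVec, dotProduct_comm a x, mul_smul]
    simp
  refine eq_zero_of_closedLoop_ray hP h (fun s => Z₀ + s • vecMulVec a v) (fun s hs x => ?_) ha
    (b := Jᵀ *ᵥ (Z₀ᵀ *ᵥ a)) (fun s => ?_)
  · rw [hmul, blockForm_add hN₂₂]
    simp only [mulVec_smul, hv, smul_zero, dotProduct_zero, add_zero, dotProduct_smul, smul_eq_mul]
    have := mul_nonneg hs (hav x)
    linarith [hZ₀ x]
  · simp only [hmul, mulVec_add, mulVec_smul, smul_smul]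

/-- If `ker N₂₂` is not contained in `ker N₁₂`, a bounded closed loop is zero. -/
theorem closedLoop_eq_zero_of_not_ker_le (hN₂₂ : N₂₂.IsSymm) (hP : P.PosDef)
    (hZ₀ : ∀ x, 0 ≤ blockForm N₁₁ N₁₂ N₂₂ x (Z₀ᵀ *ᵥ x))
    (h : ∀ Z : Matrix ν κ ℝ, (∀ x, 0 ≤ blockForm N₁₁ N₁₂ N₂₂ x (Zᵀ *ᵥ x)) →
      ∀ x, x ≠ 0 → (Jᵀ *ᵥ (Zᵀ *ᵥ x)) ⬝ᵥ P *ᵥ (Jᵀ *ᵥ (Zᵀ *ᵥ x)) < x ⬝ᵥ P *ᵥ x)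
    {v : κ → ℝ} (hv : N₂₂ *ᵥ v = 0) (hw : N₁₂ *ᵥ v ≠ 0) (d : κ → ℝ) : Jᵀ *ᵥ d = 0 := by
  have : Nonempty ν := (Function.ne_iff.mp hw).nonempty
  have hJv := closedLoop_eq_zero_of_mem_ker hN₂₂ hP hZ₀ h hv
  set w := N₁₂ *ᵥ v with hwdef
  -- The term in `v` contributes `2 (x ⬝ᵥ y s) (x ⬝ᵥ w)`. This `y` cancels exactly the linear and
  -- quadratic contributions of `s • vecMulVec w d`, so the form is constant in `s`, while `Jᵀ *ᵥ v
  -- = 0` hides the correction from the closed loop.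
  let y : ℝ → ν → ℝ := fun s =>
    -(s • (N₁₂ *ᵥ d + Z₀ *ᵥ (N₂₂ *ᵥ d)) + (s ^ 2 / 2 * (d ⬝ᵥ N₂₂ *ᵥ d)) • w)
  have hmul : ∀ (s : ℝ) (x : ν → ℝ),
      (Z₀ + s • vecMulVec w d + vecMulVec (y s) v)ᵀ *ᵥ x =
        Z₀ᵀ *ᵥ x + (s * (x ⬝ᵥ w)) • d + (x ⬝ᵥ y s) • v := by
    intro s x
    rw [transpose_add, transpose_add, transpose_smul, transpose_vecMulVec, transpose_vecMulVec,
      add_mulVec, add_mulVec, smul_mulVec, vecMulVec_mulVec, vecMulVec_mulVec,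
      dotProduct_comm w x, dotProduct_comm (y s) x, mul_smul]
    simp
  refine eq_zero_of_closedLoop_ray hP h (fun s => Z₀ + s • vecMulVec w d + vecMulVec (y s) v)
    (fun s _ x => ?_) hw (b := Jᵀ *ᵥ (Z₀ᵀ *ᵥ w)) (fun s => ?_)
  · have hz : (Z₀ᵀ *ᵥ x) ⬝ᵥ N₂₂ *ᵥ d = x ⬝ᵥ Z₀ *ᵥ (N₂₂ *ᵥ d) := by
      rw [mulVec_transpose, ← dotProduct_mulVec]
    rw [hmul, blockForm_add hN₂₂, blockForm_add hN₂₂]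
    simp only [mulVec_smul, hv, smul_zero, dotProduct_zero, add_zero, dotProduct_smul, smul_eq_mul,
      smul_dotProduct, ← hwdef, hz, y, dotProduct_neg, dotProduct_add]
    linarith [hZ₀ x]
  · simp only [hmul, mulVec_add, mulVec_smul, smul_smul, hJv, smul_zero, add_zero]

/-- Every vector pair on which the form is nonnegative comes from a solution of the QMI. -/
theorem exists_solution_through {N₁₁ : Matrix ν ν ℝ} {N₁₂ : Matrix ν κ ℝ} {N₂₂ : Matrix κ κ ℝ}
    {S : Matrix ν ν ℝ} (hS : S.PosSemidef) {C : Matrix ν κ ℝ} {B : Matrix κ κ ℝ}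
    (hq : ∀ x d, blockForm N₁₁ N₁₂ N₂₂ x (Cᵀ *ᵥ x + d) =
      x ⬝ᵥ S *ᵥ x - (B *ᵥ d) ⬝ᵥ (B *ᵥ d))
    {x : ν → ℝ} (hx : x ≠ 0) {d : κ → ℝ}
    (hd : 0 ≤ x ⬝ᵥ S *ᵥ x - (B *ᵥ d) ⬝ᵥ (B *ᵥ d)) :
    ∃ Z : Matrix ν κ ℝ, (∀ x, 0 ≤ blockForm N₁₁ N₁₂ N₂₂ x (Zᵀ *ᵥ x)) ∧
      Zᵀ *ᵥ x = Cᵀ *ᵥ x + d := by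
  have hS0 : ∀ x, 0 ≤ x ⬝ᵥ S *ᵥ x := fun x => by simpa using hS.dotProduct_mulVec_nonneg x
  have hmul : ∀ (u x' : ν → ℝ), (C + vecMulVec u d)ᵀ *ᵥ x' = Cᵀ *ᵥ x' + (x' ⬝ᵥ u) • d := by
    intro u x'
    rw [transpose_add, transpose_vecMulVec, add_mulVec, vecMulVec_mulVec, dotProduct_comm u x']
    simp
  rcases (hS0 x).eq_or_lt with h0 | hpos
  · have hxx : x ⬝ᵥ x ≠ 0 := fun e => hx (dotProduct_self_eq_zero.mp e)
    have hBd : B *ᵥ d = 0 := by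
      have h1 : (0 : ℝ) ≤ (B *ᵥ d) ⬝ᵥ (B *ᵥ d) := dotProduct_self_nonneg_real _
      exact dotProduct_self_eq_zero.mp (by linarith)
    refine ⟨C + vecMulVec ((x ⬝ᵥ x)⁻¹ • x) d, fun x' => ?_, ?_⟩
    · rw [hmul, hq, mulVec_smul, hBd]
      simpa using hS0 x'
    · rw [hmul, dotProduct_smul, smul_eq_mul, inv_mul_cancel₀ hxx, one_smul]
  -- The coefficient of `d` is 1 at `x`, and Cauchy–Schwarz for `S` keeps the form nonnegative at
  -- every other `x'`.
  · refine ⟨C + vecMulVec ((x ⬝ᵥ S *ᵥ x)⁻¹ • S *ᵥ x) d, fun x' => ?_, ?_⟩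
    · rw [hmul, hq]
      simp only [mulVec_smul, dotProduct_smul, smul_dotProduct, smul_eq_mul]
      have hcs := form_nonneg_cauchySchwarz hS x' x
      set σ := x ⬝ᵥ S *ᵥ x
      set e := x' ⬝ᵥ S *ᵥ x
      have h1 : (σ⁻¹ * e) ^ 2 * ((B *ᵥ d) ⬝ᵥ (B *ᵥ d)) ≤ (σ⁻¹ * e) ^ 2 * σ :=
        mul_le_mul_of_nonneg_left (by linarith) (sq_nonneg _)
      have h2 : (σ⁻¹ * e) ^ 2 * σ = e ^ 2 / σ := by field_simp
      have h3 : e ^ 2 / σ ≤ x' ⬝ᵥ S *ᵥ x' := by rwa [div_le_iff₀ hpos]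
      nlinarith
    · rw [hmul, dotProduct_smul, smul_eq_mul, inv_mul_cancel₀ hpos.ne', one_smul]

theorem isCompact_dotProduct_self_le (c : ℝ) : IsCompact {x : ν → ℝ | x ⬝ᵥ x ≤ c} := by
  refine Metric.isCompact_of_isClosed_isBounded
    (isClosed_le (by unfold dotProduct; fun_prop) continuous_const) ?_
  refine (Metric.isBounded_closedBall (x := (0 : ν → ℝ)) (r := |c| + 1)).subset fun x hx => ?_
  rw [mem_closedBall_zero_iff, pi_norm_le_iff_of_nonneg (by positivity)]
  intro i
  have h1 : x i * x i ≤ x ⬝ᵥ x :=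
    Finset.single_le_sum (f := fun i => x i * x i) (fun i _ => mul_self_nonneg _)
      (Finset.mem_univ i)
  have h2 : x ⬝ᵥ x ≤ c := hx
  rw [Real.norm_eq_abs]
  apply abs_le_of_sq_le_sq _ (by positivity)
  nlinarith [le_abs_self c, abs_nonneg c]

/-- Compactness: a strict implication between forms leaves a uniform margin. -/
theorem exists_uniform_margin {μ : Type*} [Fintype μ] (S P : Matrix ν ν ℝ) (G : Matrix ν ν ℝ)
    (F : Matrix ν μ ℝ) (Y : Submodule ℝ (μ → ℝ))
    (h : ∀ x, x ≠ 0 → ∀ y ∈ Y, y ⬝ᵥ y ≤ x ⬝ᵥ S *ᵥ x →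
      (G *ᵥ x + F *ᵥ y) ⬝ᵥ P *ᵥ (G *ᵥ x + F *ᵥ y) < x ⬝ᵥ P *ᵥ x) :
    ∃ δ : ℝ, 0 < δ ∧ ∀ x, x ≠ 0 → ∀ y ∈ Y, y ⬝ᵥ y ≤ x ⬝ᵥ S *ᵥ x + δ * (x ⬝ᵥ x) →
      (G *ᵥ x + F *ᵥ y) ⬝ᵥ P *ᵥ (G *ᵥ x + F *ᵥ y) ≤ x ⬝ᵥ P *ᵥ x - δ * (x ⬝ᵥ x) := by
  have hcS : Continuous fun x : ν → ℝ => x ⬝ᵥ S *ᵥ x := by unfold dotProduct mulVec; fun_prop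
  have hsph : IsCompact {x : ν → ℝ | x ⬝ᵥ x = 1} :=
    (isCompact_dotProduct_self_le 1).of_isClosed_subset
      (isClosed_eq (by unfold dotProduct; fun_prop) continuous_const) fun x hx => le_of_eq hx
  obtain ⟨c, hc⟩ := hsph.exists_bound_of_continuousOn hcS.continuousOn
  set K : Set ((ν → ℝ) × (μ → ℝ)) := {x | x ⬝ᵥ x = 1} ×ˢ ({y | y ⬝ᵥ y ≤ c + 1} ∩ Y) with hK
  have hKc : IsCompact K :=
    hsph.prod ((isCompact_dotProduct_self_le _).inter_right Y.closed_of_finiteDimensional)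
  -- Either the conclusion holds with slack or the premise is violated, so the maximum is positive
  -- on all of `K`, including where the premise fails.
  let g : (ν → ℝ) × (μ → ℝ) → ℝ := fun p =>
    max (p.1 ⬝ᵥ P *ᵥ p.1 - (G *ᵥ p.1 + F *ᵥ p.2) ⬝ᵥ P *ᵥ (G *ᵥ p.1 + F *ᵥ p.2))
      (p.2 ⬝ᵥ p.2 - p.1 ⬝ᵥ S *ᵥ p.1)
  have hg : Continuous g := by
    simp only [g, dotProduct, mulVec, Pi.add_apply]; fun_prop
  have hgpos : ∀ p ∈ K, 0 < g p := by
    rintro ⟨x, y⟩ ⟨hx, -, hy⟩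
    have hx0 : x ≠ 0 := by rintro rfl; simp at hx
    rcases le_or_gt (y ⬝ᵥ y) (x ⬝ᵥ S *ᵥ x) with h1 | h1
    · exact lt_max_of_lt_left (sub_pos.mpr (h x hx0 y hy h1))
    · exact lt_max_of_lt_right (sub_pos.mpr h1)
  obtain ⟨ε, hε, hεg⟩ : ∃ ε : ℝ, 0 < ε ∧ ∀ p ∈ K, ε ≤ g p := by
    rcases K.eq_empty_or_nonempty with hE | hne
    · exact ⟨1, one_pos, by simp [hE]⟩
    · obtain ⟨p, hp, hmin⟩ := hKc.exists_isMinOn hne hg.continuousOn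
      exact ⟨g p, hgpos p hp, fun p' hp' => hmin hp'⟩
  -- `δ < ε` rules out the second branch of the maximum; `δ ≤ 1` keeps `y` in the ball of radius
  -- squared `c + 1`.
  set δ := min (ε / 2) 1 with hδ
  have hδ0 : 0 < δ := lt_min (by linarith) one_pos
  have hδ1 : δ ≤ 1 := min_le_right _ _
  have hδε : δ < ε := (min_le_left _ _).trans_lt (by linarith)
  have unit : ∀ x, x ⬝ᵥ x = 1 → ∀ y ∈ Y, y ⬝ᵥ y ≤ x ⬝ᵥ S *ᵥ x + δ →
      (G *ᵥ x + F *ᵥ y) ⬝ᵥ P *ᵥ (G *ᵥ x + F *ᵥ y) ≤ x ⬝ᵥ P *ᵥ x - δ := by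
    intro x hx y hy hxy
    have hb : x ⬝ᵥ S *ᵥ x ≤ c := (le_abs_self _).trans (hc x hx)
    have hp : (x, y) ∈ K := ⟨hx, (by linarith : y ⬝ᵥ y ≤ c + 1), hy⟩
    rcases le_max_iff.mp (hεg _ hp) with h1 | h1
    · dsimp only at h1; linarith
    · dsimp only at h1; linarith
  refine ⟨δ, hδ0, fun x hx y hy hxy => ?_⟩
  have hxx : 0 < x ⬝ᵥ x :=
    (dotProduct_self_nonneg_real x).lt_of_ne' fun e => hx (dotProduct_self_eq_zero.mp e)
  set r := (√(x ⬝ᵥ x))⁻¹ with hr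
  have hr0 : 0 < r := by positivity
  have hr2 : r ^ 2 * (x ⬝ᵥ x) = 1 := by
    rw [hr, inv_pow, Real.sq_sqrt hxx.le, inv_mul_cancel₀ hxx.ne']
  have := unit (r • x)
    (by simp only [dotProduct_smul, smul_dotProduct, smul_eq_mul]; rw [← hr2]; ring)
    (r • y) (Y.smul_mem r hy) (by
      simp only [mulVec_smul, dotProduct_smul, smul_dotProduct, smul_eq_mul]
      have := mul_le_mul_of_nonneg_left hxy (sq_nonneg r)
      have h2 : r ^ 2 * (δ * (x ⬝ᵥ x)) = δ := by linear_combination δ * hr2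
      linarith)
  simp only [mulVec_smul, ← smul_add, dotProduct_smul, smul_dotProduct, smul_eq_mul] at this
  have h2 : r ^ 2 * (δ * (x ⬝ᵥ x)) = δ := by linear_combination δ * hr2
  refine le_of_mul_le_mul_left ?_ (pow_pos hr0 2)
  linarith

/-- The strict matrix S-lemma for `[P, 0; 0, -J P Jᵀ]`, in terms of quadratic forms. -/
theorem exists_blockForm_multiplier (hN₁₁ : N₁₁.IsSymm) (hN₂₂ : (-N₂₂).PosSemidef)
    (hP : P.PosDef) (hZ₀ : ∀ x, 0 ≤ blockForm N₁₁ N₁₂ N₂₂ x (Z₀ᵀ *ᵥ x))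
    (h : ∀ Z : Matrix ν κ ℝ, (∀ x, 0 ≤ blockForm N₁₁ N₁₂ N₂₂ x (Zᵀ *ᵥ x)) →
      ∀ x, x ≠ 0 → (Jᵀ *ᵥ (Zᵀ *ᵥ x)) ⬝ᵥ P *ᵥ (Jᵀ *ᵥ (Zᵀ *ᵥ x)) < x ⬝ᵥ P *ᵥ x) :
    ∃ α β : ℝ, 0 ≤ α ∧ 0 < β ∧ ∀ x z, α * blockForm N₁₁ N₁₂ N₂₂ x z ≤
      x ⬝ᵥ P *ᵥ x - β * (x ⬝ᵥ x) - (Jᵀ *ᵥ z) ⬝ᵥ P *ᵥ (Jᵀ *ᵥ z) := by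
  classical
  have hPs : P.IsSymm := by simpa using hP.isHermitian
  have hRs : (-N₂₂).IsSymm := by simpa using hN₂₂.isHermitian
  have hNs : N₂₂.IsSymm := by simpa using hRs.neg
  by_cases hJ : ∀ z, Jᵀ *ᵥ z = 0
  -- With zero closed loop only `β * (x ⬝ᵥ x) ≤ x ⬝ᵥ P *ᵥ x` is needed, and `α = 0` suffices.
  · obtain ⟨β, hβ, hb⟩ := exists_uniform_margin (0 : Matrix ν ν ℝ) P 0 (0 : Matrix ν ν ℝ) ⊥
      (fun x hx y _ _ => by simpa using hP.dotProduct_mulVec_pos hx)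
    refine ⟨0, β, le_rfl, hβ, fun x z => ?_⟩
    rcases eq_or_ne x 0 with rfl | hx
    · simp [hJ]
    · have hxx : (0 : ℝ) ≤ x ⬝ᵥ x := dotProduct_self_nonneg_real x
      have := hb x hx 0 (Submodule.zero_mem _) (by simp; positivity)
      simpa [hJ] using this
  obtain ⟨z₁, hz₁⟩ := not_forall.mp hJ
  have hne : Nonempty ν := (Function.ne_iff.mp hz₁).nonempty
  obtain ⟨C, hC⟩ := exists_mul_eq_of_ker_le (R := -N₂₂) (G := N₁₂) fun v hv => by
    by_contra hw
    rw [neg_mulVec, neg_eq_zero] at hv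
    exact hz₁ (closedLoop_eq_zero_of_not_ker_le hNs hP hZ₀ h hv hw z₁)
  obtain ⟨E, hE⟩ := exists_mul_eq_of_ker_le (R := -N₂₂) (G := Jᵀ) fun v hv => by
    rw [neg_mulVec, neg_eq_zero] at hv
    exact closedLoop_eq_zero_of_mem_ker hNs hP hZ₀ h hv
  obtain ⟨B, hB⟩ : ∃ B : Matrix κ κ ℝ, -N₂₂ = Bᵀ * B :=
    exists_eq_transpose_mul_self hN₂₂
  have hBd : ∀ d e : κ → ℝ, d ⬝ᵥ (-N₂₂) *ᵥ e = (B *ᵥ d) ⬝ᵥ (B *ᵥ e) := fun d e => by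
    rw [hB, ← mulVec_mulVec, dotProduct_mulVec, vecMul_transpose]
  set S := N₁₁ + C * (-N₂₂) * Cᵀ with hSdef
  have hSs : S.IsSymm := by
    rw [IsSymm, hSdef, transpose_add, hN₁₁.eq, transpose_mul, transpose_mul, transpose_transpose,
      hRs.eq, Matrix.mul_assoc]
  have hq : ∀ x d, blockForm N₁₁ N₁₂ N₂₂ x (Cᵀ *ᵥ x + d) =
      x ⬝ᵥ S *ᵥ x - (B *ᵥ d) ⬝ᵥ (B *ᵥ d) := by
    intro x d
    have e1 : x ⬝ᵥ N₁₂ *ᵥ d = (Cᵀ *ᵥ x) ⬝ᵥ (-N₂₂) *ᵥ d := by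
      rw [← hC, ← mulVec_mulVec, dotProduct_mulVec, ← mulVec_transpose]
    have e2 : x ⬝ᵥ N₁₂ *ᵥ (Cᵀ *ᵥ x) = (Cᵀ *ᵥ x) ⬝ᵥ (-N₂₂) *ᵥ (Cᵀ *ᵥ x) := by
      rw [← hC, ← mulVec_mulVec, dotProduct_mulVec, ← mulVec_transpose]
    rw [blockForm_add hNs, ← hBd, hSdef, add_mulVec, dotProduct_add, transpose_mulVec_form,
      e1, blockForm, e2]
    simp only [neg_mulVec, dotProduct_neg]
    ring
  have hS : S.PosSemidef := by
    refine .of_dotProduct_mulVec_nonneg (by simpa [IsHermitian] using hSs.eq) fun x => ?_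
    have h1 := hq x (Z₀ᵀ *ᵥ x - Cᵀ *ᵥ x)
    rw [add_sub_cancel] at h1
    have h2 := hZ₀ x
    have h3 : (0 : ℝ) ≤ (B *ᵥ (Z₀ᵀ *ᵥ x - Cᵀ *ᵥ x)) ⬝ᵥ (B *ᵥ (Z₀ᵀ *ᵥ x - Cᵀ *ᵥ x)) :=
      dotProduct_self_nonneg_real _
    rw [star_trivial]
    linarith
  have hJd : ∀ x d, Jᵀ *ᵥ (Cᵀ *ᵥ x + d) = (Jᵀ * Cᵀ) *ᵥ x + (E * Bᵀ) *ᵥ (B *ᵥ d) := by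
    intro x d
    rw [mulVec_add, mulVec_mulVec, mulVec_mulVec, Matrix.mul_assoc, ← hB, hE]
  obtain ⟨δ, hδ, hmargin⟩ := exists_uniform_margin S P (Jᵀ * Cᵀ) (E * Bᵀ)
    -- Only vectors `B *ᵥ d` come from solutions, hence the restriction to the range of `B`.
    (LinearMap.range B.mulVecLin) (by
      rintro x hx _ ⟨d, rfl⟩ hd
      rw [mulVecLin_apply] at hd ⊢
      obtain ⟨Z, hZ, hZx⟩ := exists_solution_through hS hq hx (d := d) (by linarith)
      have := h Z hZ x hx
      rwa [hZx, hJd] at this)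
  have himp : ∀ x z, 0 ≤ blockForm N₁₁ N₁₂ N₂₂ x z + δ * (x ⬝ᵥ x) →
      0 ≤ x ⬝ᵥ P *ᵥ x - δ * (x ⬝ᵥ x) - (Jᵀ *ᵥ z) ⬝ᵥ P *ᵥ (Jᵀ *ᵥ z) := by
    intro x z hxz
    obtain ⟨d, rfl⟩ : ∃ d, z = Cᵀ *ᵥ x + d := ⟨z - Cᵀ *ᵥ x, by simp⟩
    rw [hq] at hxz
    rw [hJd]
    rcases eq_or_ne x 0 with rfl | hx
    · have h1 : (0 : ℝ) ≤ (B *ᵥ d) ⬝ᵥ (B *ᵥ d) := dotProduct_self_nonneg_real _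
      simp only [mulVec_zero, dotProduct_zero, mul_zero, add_zero] at hxz
      have h2 : B *ᵥ d = 0 := dotProduct_self_eq_zero.mp (by linarith)
      simp [h2]
    · linarith [hmargin x hx (B *ᵥ d) ⟨d, rfl⟩ (by linarith)]
  have hform₁ : ∀ w, w ⬝ᵥ fromBlocks (P - δ • 1) 0 0ᵀ (-(J * P * Jᵀ)) *ᵥ w =
      (w ∘ Sum.inl) ⬝ᵥ P *ᵥ (w ∘ Sum.inl) - δ * ((w ∘ Sum.inl) ⬝ᵥ (w ∘ Sum.inl)) -
        (Jᵀ *ᵥ (w ∘ Sum.inr)) ⬝ᵥ P *ᵥ (Jᵀ *ᵥ (w ∘ Sum.inr)) := by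
    intro w
    conv_lhs => rw [← Sum.elim_comp_inl_inr w]
    rw [form_fromBlocks, blockForm, neg_mulVec, dotProduct_neg, transpose_mulVec_form, sub_mulVec,
      smul_mulVec]
    simp [dotProduct_sub]
    ring
  have hform₂ : ∀ w, w ⬝ᵥ fromBlocks (N₁₁ + δ • 1) N₁₂ N₁₂ᵀ N₂₂ *ᵥ w =
      blockForm N₁₁ N₁₂ N₂₂ (w ∘ Sum.inl) (w ∘ Sum.inr) +
        δ * ((w ∘ Sum.inl) ⬝ᵥ (w ∘ Sum.inl)) := by
    intro w
    conv_lhs => rw [← Sum.elim_comp_inl_inr w]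
    rw [form_fromBlocks, blockForm, add_mulVec, smul_mulVec]
    simp [dotProduct_add, blockForm]
    ring
  obtain ⟨α, hα, hfin⟩ := exists_multiplier_of_form_nonneg
    (M := fromBlocks (P - δ • 1) 0 0ᵀ (-(J * P * Jᵀ)))
    (N := fromBlocks (N₁₁ + δ • 1) N₁₂ N₁₂ᵀ N₂₂)
    (IsSymm.fromBlocks (hPs.sub (isSymm_one.smul δ)) rfl
      (by simp [IsSymm, transpose_mul, hPs.eq, Matrix.mul_assoc]))
    (IsSymm.fromBlocks (hN₁₁.add (isSymm_one.smul δ)) rfl hNs)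
    (fun w hw => by rw [hform₁]; rw [hform₂] at hw; exact himp _ _ hw)
    -- The relaxation by `δ` makes the form positive here, although the original form may vanish.
    (w₀ := Sum.elim 1 (Z₀ᵀ *ᵥ 1)) (by
      rw [hform₂]
      have h1 : (0 : ℝ) < (1 : ν → ℝ) ⬝ᵥ 1 := by simp [Fintype.card_pos]
      have := hZ₀ 1
      have := mul_pos hδ h1
      simp only [Sum.elim_comp_inl, Sum.elim_comp_inr]
      linarith)
  refine ⟨α, δ, hα, hδ, fun x z => ?_⟩
  have := hfin (Sum.elim x z)
  rw [hform₁, hform₂] at this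
  simp only [Sum.elim_comp_inl, Sum.elim_comp_inr] at this
  have hxx : (0 : ℝ) ≤ α * (δ * (x ⬝ᵥ x)) :=
    mul_nonneg hα (mul_nonneg hδ.le (dotProduct_self_nonneg_real x))
  linarith

end BlockForm

/-! ### From plants and data to quadratic forms -/

theorem quadForm_form {n : ℕ} {κ : Type} [Fintype κ] (Φ : Matrix (Fin n ⊕ κ) (Fin n ⊕ κ) ℝ)
    (Z : Matrix (Fin n) κ ℝ) (x : Fin n → ℝ) :
    x ⬝ᵥ quadForm Φ Z *ᵥ x = Sum.elim x (Zᵀ *ᵥ x) ⬝ᵥ Φ *ᵥ Sum.elim x (Zᵀ *ᵥ x) := by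
  have h : fromRows (1 : Matrix (Fin n) (Fin n) ℝ) Zᵀ *ᵥ x = Sum.elim x (Zᵀ *ᵥ x) := by
    rw [fromRows_mulVec, one_mulVec]
  rw [quadForm, ← mulVec_mulVec, h, ← mulVec_mulVec, dotProduct_mulVec, vecMul_transpose, h]

theorem quadForm_isHermitian {n : ℕ} {κ : Type} [Fintype κ]
    {Φ : Matrix (Fin n ⊕ κ) (Fin n ⊕ κ) ℝ} (hΦ : Φ.IsSymm) (Z : Matrix (Fin n) κ ℝ) :
    (quadForm Φ Z).IsHermitian := by
  simp [IsHermitian, quadForm, conjTranspose_eq_transpose_of_trivial, transpose_mul, hΦ.eq,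
    Matrix.mul_assoc]

theorem mem_QBP_iff {n : ℕ} {κ : Type} [Fintype κ] {Φ : Matrix (Fin n ⊕ κ) (Fin n ⊕ κ) ℝ}
    (hΦ : Φ.IsSymm) (Z : Matrix (Fin n) κ ℝ) :
    Z ∈ QBP Φ ↔
      ∀ x, 0 ≤ Sum.elim x (Zᵀ *ᵥ x) ⬝ᵥ Φ *ᵥ Sum.elim x (Zᵀ *ᵥ x) := by
  simp only [← quadForm_form]
  constructor
  · intro h x
    simpa using PosSemidef.dotProduct_mulVec_nonneg h x
  · intro h
    exact .of_dotProduct_mulVec_nonneg (quadForm_isHermitian hΦ Z) fun x => by simpa using h x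

theorem mem_SQBP_iff {n : ℕ} {κ : Type} [Fintype κ] {Φ : Matrix (Fin n ⊕ κ) (Fin n ⊕ κ) ℝ}
    (hΦ : Φ.IsSymm) (Z : Matrix (Fin n) κ ℝ) :
    Z ∈ SQBP Φ ↔
      ∀ x, x ≠ 0 → 0 < Sum.elim x (Zᵀ *ᵥ x) ⬝ᵥ Φ *ᵥ Sum.elim x (Zᵀ *ᵥ x) := by
  simp only [← quadForm_form]
  constructor
  · intro h x hx
    simpa using PosDef.dotProduct_mulVec_pos h hx
  · intro h
    exact .of_dotProduct_mulVec_pos (quadForm_isHermitian hΦ Z) fun x hx => by simpa using h x hx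

variable {n m L T : ℕ}

/-- The map `ω ⊗ I` stacked over the gain `K`: the closed loop at `ω` is `[A₁, …, A_L, B]` times
this matrix. -/
def vertexGain (ω : Fin L → ℝ) (K : Matrix (Fin m) (Fin n) ℝ) :
    Matrix ((Fin L × Fin n) ⊕ Fin m) (Fin n) ℝ :=
  fromRows (Matrix.of fun lj j => ω lj.1 * (1 : Matrix (Fin n) (Fin n) ℝ) lj.2 j) K

/-- The Kronecker blocks are the blocks of one product `J P Jᵀ`; this exposes the closed loop `Jᵀ
Zᵀ`. -/
theorem vertexBlock_eq (ω : Fin L → ℝ) (Q : Matrix (Fin n) (Fin n) ℝ)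
    {P : Matrix (Fin n) (Fin n) ℝ} (hP : P.IsSymm) (K : Matrix (Fin m) (Fin n) ℝ) :
    vertexBlock ω Q P (K * P) (-(K * P * Kᵀ)) =
      fromBlocks Q 0 0ᵀ (-(vertexGain ω K * P * (vertexGain ω K)ᵀ)) := by
  set W : Matrix (Fin L × Fin n) (Fin n) ℝ :=
    Matrix.of fun lj j => ω lj.1 * (1 : Matrix (Fin n) (Fin n) ℝ) lj.2 j with hW
  have h11 : W * P * Wᵀ = vecMulVec ω ω ⊗ₖ P := by
    ext ⟨l, i⟩ ⟨l', j⟩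
    simp [hW, Matrix.mul_apply, vecMulVec_apply, Matrix.one_apply]
    ring
  have h21 : K * P * Wᵀ = rowKron ω (K * P) := by
    ext i ⟨l, j⟩
    simp [hW, Matrix.mul_apply, rowKron, Matrix.one_apply]
    ring
  have h12 : W * P * Kᵀ = (rowKron ω (K * P))ᵀ := by
    rw [← h21]
    simp [transpose_mul, hP.eq, Matrix.mul_assoc]
  rw [vertexBlock, vertexGain, ← hW, fromRows_mul, transpose_fromRows, fromRows_mul_fromCols,
    h11, h12, h21, fromBlocks_neg, transpose_zero, transpose_neg]

/-- The discrepancy is affine in the concatenation `[A₁, …, A_L, B]`. -/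
theorem discrepancy_eq (D : Data n m L T) (p : Plant n m L) :
    discrepancy D p = D.Xplus +
      p.concat * fromRows (-khatriRao D.Theta D.Xminus) (-D.U) := by
  ext i t
  simp only [discrepancy, Plant.concat, fromCols_mul_fromRows, Matrix.add_apply, Matrix.of_apply,
    Matrix.mul_neg, Matrix.neg_apply, khatriRao, Matrix.mul_apply, Fintype.sum_prod_type, mulVec,
    dotProduct, Matrix.sum_apply, Matrix.smul_apply, smul_eq_mul, Finset.sum_mul]
  rw [Finset.sum_comm]
  have : ∀ l j, D.Theta l t * p.A l i j * D.Xminus j t =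
      p.A l i j * (D.Theta l t * D.Xminus j t) := fun l j => by ring
  simp only [this]
  ring

/-- The transposed data matrix sends `[I; Zᵀ]` to `[I; Wᵀ]`, because the discrepancy `W` is affine
in `Z`. -/
theorem quadForm_Psi (D : Data n m L T) (Φ : Matrix (Fin n ⊕ Fin T) (Fin n ⊕ Fin T) ℝ)
    (p : Plant n m L) : quadForm (Psi D Φ) p.concat = quadForm Φ (discrepancy D p) := by
  have h : (dataMatrix D)ᵀ * fromRows (1 : Matrix (Fin n) (Fin n) ℝ) p.concatᵀ =
      fromRows 1 (discrepancy D p)ᵀ := by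
    rw [discrepancy_eq, dataMatrix, fromBlocks_transpose, fromBlocks_mul_fromRows]
    simp [transpose_add, transpose_mul]
  rw [quadForm, quadForm, ← h, Psi, transpose_mul, transpose_transpose]
  simp only [Matrix.mul_assoc]

/-- Needed because the S-lemma quantifies over all matrices `Z`, not only over plants. -/
theorem Plant.exists_concat_eq (Z : Matrix (Fin n) ((Fin L × Fin n) ⊕ Fin m) ℝ) :
    ∃ p : Plant n m L, p.concat = Z :=
  ⟨⟨fun l => Matrix.of fun i j => Z i (Sum.inl (l, j)), Z.toCols₂⟩, by
    ext i (⟨l, j⟩ | k) <;> rfl⟩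

theorem mem_consistencySet_iff (D : Data n m L T)
    (Φ : Matrix (Fin n ⊕ Fin T) (Fin n ⊕ Fin T) ℝ) (p : Plant n m L) :
    p ∈ consistencySet D Φ ↔ p.concat ∈ QBP (Psi D Φ) := by
  simp only [consistencySet, QBP, Set.mem_ofPred_eq, quadForm_Psi]

theorem Psi_isSymm (D : Data n m L T) {Φ : Matrix (Fin n ⊕ Fin T) (Fin n ⊕ Fin T) ℝ}
    (hΦ : Φ.IsSymm) : (Psi D Φ).IsSymm := by
  simp [IsSymm, Psi, transpose_mul, hΦ.eq, Matrix.mul_assoc]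

theorem Psi_toBlocks₂₂ (D : Data n m L T) {Φ : Matrix (Fin n ⊕ Fin T) (Fin n ⊕ Fin T) ℝ}
    (hΦ : IsNoiseMatrix Φ) : (-(Psi D Φ).toBlocks₂₂).PosSemidef := by
  set H := fromRows (-khatriRao D.Theta D.Xminus) (-D.U) with hH
  have : (Psi D Φ).toBlocks₂₂ = H * Φ.toBlocks₂₂ * Hᵀ := by
    rw [Psi, dataMatrix, ← hH]
    conv_lhs => rw [← fromBlocks_toBlocks Φ]
    rw [fromBlocks_transpose, fromBlocks_multiply, fromBlocks_multiply, toBlocks_fromBlocks₂₂]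
    simp
  rw [this]
  have := hΦ.2.mul_mul_conjTranspose_same H
  rwa [conjTranspose_eq_transpose_of_trivial, Matrix.mul_neg, Matrix.neg_mul] at this

theorem fromBlocks_toBlocks_of_isSymm {ν κ : Type*} {N : Matrix (ν ⊕ κ) (ν ⊕ κ) ℝ}
    (hN : N.IsSymm) :
    fromBlocks N.toBlocks₁₁ N.toBlocks₁₂ N.toBlocks₁₂ᵀ N.toBlocks₂₂ = N := by
  conv_rhs => rw [← fromBlocks_toBlocks N]
  congr 1
  ext i j
  exact hN.apply _ _

theorem stabMatrix_form (ω : Fin L → ℝ) {P : Matrix (Fin n) (Fin n) ℝ} (hP : P.IsSymm)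
    (K : Matrix (Fin m) (Fin n) ℝ) (x : Fin n → ℝ) (z : (Fin L × Fin n) ⊕ Fin m → ℝ) :
    Sum.elim x z ⬝ᵥ stabMatrix ω P K *ᵥ Sum.elim x z = x ⬝ᵥ P *ᵥ x -
      ((vertexGain ω K)ᵀ *ᵥ z) ⬝ᵥ P *ᵥ ((vertexGain ω K)ᵀ *ᵥ z) := by
  rw [stabMatrix, vertexBlock_eq ω P hP, form_fromBlocks, blockForm, neg_mulVec, dotProduct_neg,
    transpose_mulVec_form]
  simp [sub_eq_add_neg]

theorem certMatrix_form
    (Ψ : Matrix (Fin n ⊕ ((Fin L × Fin n) ⊕ Fin m)) (Fin n ⊕ ((Fin L × Fin n) ⊕ Fin m)) ℝ)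
    (ω : Fin L → ℝ) {P : Matrix (Fin n) (Fin n) ℝ} (hP : P.IsSymm)
    (K : Matrix (Fin m) (Fin n) ℝ) (α β : ℝ) (x : Fin n → ℝ)
    (z : (Fin L × Fin n) ⊕ Fin m → ℝ) :
    Sum.elim x z ⬝ᵥ certMatrix Ψ ω P K α β *ᵥ Sum.elim x z =
      x ⬝ᵥ P *ᵥ x - β * (x ⬝ᵥ x) -
        ((vertexGain ω K)ᵀ *ᵥ z) ⬝ᵥ P *ᵥ ((vertexGain ω K)ᵀ *ᵥ z) -
        α * (Sum.elim x z ⬝ᵥ Ψ *ᵥ Sum.elim x z) := by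
  rw [certMatrix, vertexBlock_eq ω _ hP, sub_mulVec, dotProduct_sub, form_fromBlocks, blockForm,
    neg_mulVec, dotProduct_neg, transpose_mulVec_form, sub_mulVec, smul_mulVec, smul_mulVec]
  simp [dotProduct_sub]
  ring

theorem stabMatrix_isSymm (ω : Fin L → ℝ) {P : Matrix (Fin n) (Fin n) ℝ} (hP : P.IsSymm)
    (K : Matrix (Fin m) (Fin n) ℝ) : (stabMatrix ω P K).IsSymm := by
  rw [stabMatrix, vertexBlock_eq ω P hP]
  exact IsSymm.fromBlocks hP rfl (by simp [IsSymm, transpose_mul, hP.eq, Matrix.mul_assoc])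

theorem certMatrix_isSymm
    {Ψ : Matrix (Fin n ⊕ ((Fin L × Fin n) ⊕ Fin m)) (Fin n ⊕ ((Fin L × Fin n) ⊕ Fin m)) ℝ}
    (hΨ : Ψ.IsSymm) (ω : Fin L → ℝ) {P : Matrix (Fin n) (Fin n) ℝ} (hP : P.IsSymm)
    (K : Matrix (Fin m) (Fin n) ℝ) (α β : ℝ) : (certMatrix Ψ ω P K α β).IsSymm := by
  rw [certMatrix, vertexBlock_eq ω _ hP]
  exact IsSymm.sub (IsSymm.fromBlocks (hP.sub (isSymm_one.smul β)) rfl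
    (by simp [IsSymm, transpose_mul, hP.eq, Matrix.mul_assoc])) (hΨ.smul α)

theorem consistent_subset_SQBP_iff (D : Data n m L T)
    {Φ : Matrix (Fin n ⊕ Fin T) (Fin n ⊕ Fin T) ℝ} (hΦ : IsNoiseMatrix Φ) (ω : Fin L → ℝ)
    {truth : Plant n m L} (htruth : discrepancy D truth ∈ QBP Φ)
    {P : Matrix (Fin n) (Fin n) ℝ} (hP : P.PosDef) (K : Matrix (Fin m) (Fin n) ℝ) :
    (∀ p ∈ consistencySet D Φ, p.concat ∈ SQBP (stabMatrix ω P K)) ↔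
      ∃ α β : ℝ, 0 ≤ α ∧ 0 < β ∧ (certMatrix (Psi D Φ) ω P K α β).PosSemidef := by
  have hPs : P.IsSymm := by simpa using hP.isHermitian
  have hΨ := Psi_isSymm D hΦ.1
  have hM := stabMatrix_isSymm ω hPs K
  have hΨform : ∀ x z, Sum.elim x z ⬝ᵥ Psi D Φ *ᵥ Sum.elim x z =
      blockForm (Psi D Φ).toBlocks₁₁ (Psi D Φ).toBlocks₁₂ (Psi D Φ).toBlocks₂₂ x z := by
    intro x z
    rw [← form_fromBlocks, fromBlocks_toBlocks_of_isSymm hΨ]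
  constructor
  · intro h
    have htr := (mem_consistencySet_iff D Φ truth).mp htruth
    rw [mem_QBP_iff hΨ] at htr
    simp only [hΨform] at htr
    obtain ⟨α, β, hα, hβ, hcert⟩ := exists_blockForm_multiplier (J := vertexGain ω K)
      (by ext i j; exact hΨ.apply _ _) (Psi_toBlocks₂₂ D hΦ) hP htr (fun Z hZ x hx => by
        obtain ⟨p, rfl⟩ := Plant.exists_concat_eq Z
        have hp := h p ((mem_consistencySet_iff D Φ p).mpr
          ((mem_QBP_iff hΨ _).mpr (by simpa only [hΨform] using hZ)))
        have := (mem_SQBP_iff hM _).mp hp x hx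
        rwa [stabMatrix_form ω hPs, sub_pos] at this)
    refine ⟨α, β, hα, hβ, .of_dotProduct_mulVec_nonneg
      (by simpa [IsHermitian] using (certMatrix_isSymm hΨ ω hPs K α β).eq) fun w => ?_⟩
    rw [star_trivial, ← Sum.elim_comp_inl_inr w, certMatrix_form _ ω hPs, hΨform]
    linarith [hcert (w ∘ Sum.inl) (w ∘ Sum.inr)]
  · rintro ⟨α, β, hα, hβ, hcert⟩ p hp
    rw [mem_consistencySet_iff, mem_QBP_iff hΨ] at hp
    rw [mem_SQBP_iff hM]
    intro x hx
    have h1 := hcert.dotProduct_mulVec_nonneg (Sum.elim x (p.concatᵀ *ᵥ x))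
    rw [star_trivial, certMatrix_form _ ω hPs] at h1
    rw [stabMatrix_form ω hPs]
    have hxx : 0 < x ⬝ᵥ x :=
      (dotProduct_self_nonneg_real x).lt_of_ne' fun e => hx (dotProduct_self_eq_zero.mp e)
    linarith [mul_nonneg hα (hp x), mul_pos hβ hxx]

/-- Schur complement of the last block `P`: the subtracted term `S P⁻¹ Sᵀ` is `K P Kᵀ` for `K = S
P⁻¹`, and the multiplier term is untouched. -/
theorem certMatrix_posSemidef_iff
    (Ψ : Matrix (Fin n ⊕ ((Fin L × Fin n) ⊕ Fin m)) (Fin n ⊕ ((Fin L × Fin n) ⊕ Fin m)) ℝ)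
    (ω : Fin L → ℝ) {P : Matrix (Fin n) (Fin n) ℝ} (hP : P.PosDef)
    (S : Matrix (Fin m) (Fin n) ℝ) (α β : ℝ) :
    (certMatrix Ψ ω P (S * P⁻¹) α β).PosSemidef ↔ (sdpMatrix Ψ ω P S α β).PosSemidef := by
  have hPs : P.IsSymm := by simpa using hP.isHermitian
  have hdet : IsUnit P.det := (isUnit_iff_isUnit_det P).mp hP.isUnit
  let _ : Invertible P := hP.isUnit.invertible
  set E : Matrix (Fin n ⊕ ((Fin L × Fin n) ⊕ Fin m)) (Fin n) ℝ :=
    fromRows 0 (fromRows 0 S) with hE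
  have hEt : (fromCols 0 (fromCols 0 Sᵀ) :
      Matrix (Fin n) (Fin n ⊕ ((Fin L × Fin n) ⊕ Fin m)) ℝ) = Eᴴ := by
    rw [hE, conjTranspose_eq_transpose_of_trivial, transpose_fromRows, transpose_fromRows,
      transpose_zero, transpose_zero]
  have hsdp : sdpMatrix Ψ ω P S α β =
      fromBlocks (vertexBlock ω (P - β • 1) P S 0 - α • Ψ) E Eᴴ P := by
    rw [sdpMatrix, ← hE, hEt, fromBlocks_smul, sub_eq_add_neg, fromBlocks_neg, fromBlocks_add]
    simp [sub_eq_add_neg]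
  have hSP : S * P⁻¹ * P = S := nonsing_inv_mul_cancel_right P S hdet
  have hEPE : E * P⁻¹ * Eᴴ = fromBlocks 0 0 0 (fromBlocks 0 0 0 (S * P⁻¹ * Sᵀ)) := by
    rw [← hEt, hE]
    simp only [fromRows_mul, Matrix.zero_mul]
    ext (i | i | i) (j | j | j) <;> simp [Matrix.mul_apply, fromRows_apply_inr]
  rw [hsdp, hP.fromBlocks₂₂, hEPE]
  have : certMatrix Ψ ω P (S * P⁻¹) α β = vertexBlock ω (P - β • 1) P S 0 - α • Ψ -
      fromBlocks 0 0 0 (fromBlocks 0 0 0 (S * P⁻¹ * Sᵀ)) := by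
    rw [certMatrix, hSP, transpose_mul, transpose_nonsing_inv, hPs.eq, ← Matrix.mul_assoc,
      sub_right_comm]
    congr 1
    simp [vertexBlock, sub_eq_add_neg, fromBlocks_neg, fromBlocks_add]
  rw [this]

end LPV

theorem theorem3 {n m L T Nv : ℕ} (D : LPV.Data n m L T)
    (Φ : Matrix (Fin n ⊕ Fin T) (Fin n ⊕ Fin T) ℝ) (hΦ : LPV.IsNoiseMatrix Φ)
    (ω : Fin Nv → Fin L → ℝ)
    (truth : LPV.Plant n m L) (htruth : LPV.discrepancy D truth ∈ LPV.QBP Φ) :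
    (∀ (P : Matrix (Fin n) (Fin n) ℝ) (K : Fin Nv → Matrix (Fin m) (Fin n) ℝ), P.PosDef →
      ∀ v : Fin Nv,
        (∀ p ∈ LPV.consistencySet D Φ, p.concat ∈ LPV.SQBP (LPV.stabMatrix (ω v) P (K v))) ↔
          ∃ α β : ℝ, 0 ≤ α ∧ 0 < β ∧
            (LPV.certMatrix (LPV.Psi D Φ) (ω v) P (K v) α β).PosSemidef) ∧
    (∀ (P : Matrix (Fin n) (Fin n) ℝ) (S : Fin Nv → Matrix (Fin m) (Fin n) ℝ), P.PosDef →
      ∀ (v : Fin Nv) (α β : ℝ),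
        (LPV.certMatrix (LPV.Psi D Φ) (ω v) P (S v * P⁻¹) α β).PosSemidef ↔
          (LPV.sdpMatrix (LPV.Psi D Φ) (ω v) P (S v) α β).PosSemidef) ∧
    (∀ (P : Matrix (Fin n) (Fin n) ℝ) (S : Fin Nv → Matrix (Fin m) (Fin n) ℝ),
      (∃ α β : Fin Nv → ℝ, LPV.SDPFeasible D Φ ω P α β S) ↔
        P.PosDef ∧ ∀ v : Fin Nv, ∀ p ∈ LPV.consistencySet D Φ,
          p.concat ∈ LPV.SQBP (LPV.stabMatrix (ω v) P (S v * P⁻¹))) := by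
  refine ⟨fun P K hP v => LPV.consistent_subset_SQBP_iff D hΦ (ω v) htruth hP (K v),
    fun P S hP v α β => LPV.certMatrix_posSemidef_iff _ (ω v) hP (S v) α β, fun P S => ?_⟩
  constructor
  · rintro ⟨α, β, hP, h⟩
    refine ⟨hP, fun v => (LPV.consistent_subset_SQBP_iff D hΦ (ω v) htruth hP _).mpr ?_⟩
    obtain ⟨hα, hβ, hsdp⟩ := h v
    exact ⟨α v, β v, hα, hβ, (LPV.certMatrix_posSemidef_iff _ (ω v) hP (S v) _ _).mpr hsdp⟩
  · rintro ⟨hP, h⟩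
    choose α β hα hβ hcert using fun v =>
      (LPV.consistent_subset_SQBP_iff D hΦ (ω v) htruth hP _).mp (h v)
    exact ⟨α, β, hP, fun v => ⟨hα v, hβ v,
      (LPV.certMatrix_posSemidef_iff _ (ω v) hP (S v) _ _).mp (hcert v)⟩⟩
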